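/- All topological spaces are assumed to be Hausdorff and completely regular. A \emph{retractional skeleton} in a countably compact space $X$ is a family $\{r_s\}_{s\in\Gamma}$ of continuous retractions $r_s:X\to X$ (that is, $r_s\circ r_s=r_s$), indexed by a non-empty up-directed partially ordered set $\Gamma$, such that (i) $r_s[X]$ is compact and metrizable for every $s\in\Gamma$; (ii) if $s\le t$ in $\Gamma$, then $r_s=r_t\circ r_s=r_s\circ r_t$; (iii) for every sequence $s_0\le s_1\le\cdots$ in $\Gamma$ the supremum $t=\sup_{n} s_n$ exists in $\Gamma$, and $r_t(x)=\lim_{n\to\infty} r_{s_n}(x)$ for every $x\in X$; (iv) $x=\lim_{s\in\Gamma} r_s(x)$ for every $x\in X$. The skeleton is \emph{full} if $\bigcup_{s\in\Gamma} r_s[X]=X$. A \emph{non-commutative Corson countably compact space} is a countably compact space with a full retractional skeleton. A subset $Y$ of a space $X$ is \emph{countably closed} if $\overline{C}\subseteq Y$ for every countable $C\subseteq Y$. Given a family $\{X_\alpha\}_{\alpha\in A}$ of countably compact spaces, a \emph{one-point countably compact modification of the topological sum} of the family is a countably compact space $Z=\bigl(\bigoplus_{\alpha\in A}X_\alpha\bigr)\cup\{\infty\}$,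 with $\infty\notin\bigoplus_{\alpha\in A} X_\alpha$, in which each $X_\alpha$ (with its own topology) is a clopen subspace. Theorem. The class of non-commutative Corson countably compact spaces is closed under the following operations. (1) Countably closed subspaces: if $X$ is in the class and $Y\subseteq X$ is countably closed, then $Y$ is in the class. (2) Countable products: if $I$ is countable and $X_i$ is in the class for every $i\in I$, then $\prod_{i\in I}X_i$ is in the class. (3) Finite topological sums: if $I$ is finite and $X_i$ is in the class for every $i\in I$, then $\bigoplus_{i\in I}X_i$ is in the class. (4) One-point countably compact modifications of topological sums: if $A$ is any set, $X_\alpha$ is in the class for every $\alpha\in A$, and $Z$ is a one-point countably compact modification of $\bigoplus_{\alpha\in A}X_\alpha$, then $Z$ is in the class. (5) Quotient images: if $X$ is in the class, $Y$ is a (Hausdorff, completely regular) space and $f:X\to Y$ is a quotient map onto $Y$, then $Y$ is in the class. -/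

import Mathlib

open Set Filter Topology

universe u v

/-- `A` is countably closed in `X`: the closure of every countable subset of `A` is contained
in `A`. -/
def IsCountablyClosed {X : Type u} [TopologicalSpace X] (A : Set X) : Prop :=
  ∀ C : Set X, C ⊆ A → C.Countable → closure C ⊆ A

/-- `r = (r_s)_{s ∈ Γ}` is a retractional skeleton in `X`, indexed by the (nonempty) up-directed
partially ordered set `Γ`. -/
structure IsRetractionalSkeleton {X : Type u} [TopologicalSpace X] {Γ : Type v} [PartialOrder Γ]
    (r : Γ → X → X) : Prop where
  nonempty : Nonempty Γ
  directed : ∀ s t : Γ, ∃ p : Γ, s ≤ p ∧ t ≤ p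
  continuous : ∀ s, Continuous (r s)
  retraction : ∀ s, r s ∘ r s = r s
  isCompact_range : ∀ s, IsCompact (range (r s))
  metrizable_range : ∀ s, TopologicalSpace.MetrizableSpace (range (r s))
  comp_eq_left : ∀ s t, s ≤ t → r s = r t ∘ r s
  comp_eq_right : ∀ s t, s ≤ t → r s = r s ∘ r t
  exists_sup : ∀ s : ℕ → Γ, Monotone s → ∃ t : Γ, IsLUB (range s) t ∧
    ∀ x : X, Tendsto (fun n => r (s n) x) atTop (𝓝 (r t x))
  tendsto_id : ∀ x : X, Tendsto (fun s => r s x) atTop (𝓝 x)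

/-- The set induced by a family of retractions. -/
def inducedSet {X : Type u} {Γ : Type v} (r : Γ → X → X) : Set X :=
  ⋃ s, range (r s)

/-- `X` has a full retractional skeleton. -/
def HasFullRetractionalSkeleton (X : Type u) [TopologicalSpace X] : Prop :=
  ∃ (Γ : Type u) (_ : PartialOrder Γ) (r : Γ → X → X),
    IsRetractionalSkeleton r ∧ inducedSet r = univ

/-- `X` is a non-commutative Corson countably compact space: a (Hausdorff, completely regular)
countably compact space with a full retractional skeleton. -/
structure IsNoncommCorson (X : Type u) [TopologicalSpace X] : Prop where
  t35Space : T35Space X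
  countablyCompactSpace : CountablyCompactSpace X
  hasFullRetractionalSkeleton : HasFullRetractionalSkeleton X

/-- `Z` is a one-point countably compact modification of the topological sum of the family
`(X a)_{a ∈ A}`: as a set `Z` is the disjoint union of the (images under `e a` of the) `X a` and
of the one-point set `{infty}`, each `X a` is a clopen subspace of `Z`, and `Z` is countably
compact. -/
structure IsOnePointCountablyCompactModification {A : Type v} (X : A → Type u)
    [∀ a, TopologicalSpace (X a)] (Z : Type (max u v)) [TopologicalSpace Z]
    (e : ∀ a, X a → Z) (infty : Z) : Prop where
  countablyCompact_summand : ∀ a, CountablyCompactSpace (X a)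
  countablyCompactSpace : CountablyCompactSpace Z
  isEmbedding : ∀ a, IsEmbedding (e a)
  isClopen_range : ∀ a, IsClopen (range (e a))
  disjoint : ∀ a b, a ≠ b → Disjoint (range (e a)) (range (e b))
  iUnion_range : (⋃ a, range (e a)) = {infty}ᶜ

/-!
Each operation is carried out on a full skeleton `r` itself (`IsFullSkeleton`). Fullness makes every
countable set fixed by a single `r t`, hence contained in a compact metrizable range
(`IsFullSkeleton.exists_ge_fixed_of_countable`). Countable compactness of the resulting spaces is
therefore automatic, although it is not productive in general.

The main step is `IsFullSkeleton.exists_ge_mapsTo`: if `Y` is countably closed, the indices `t`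
with `r t '' Y ⊆ Y` are cofinal. They are also closed under suprema of increasing sequences, so
restricting the skeleton to these indices and to `Y` gives a full skeleton on `Y`.

The same step handles quotients. For a quotient map `f : X → Y` with Hausdorff `Y`, the kernel
`{p | f p.1 = f p.2}` is closed in `X × X`, on which the maps `r s × r s` form a full skeleton
indexed by the same poset. Cofinally many `r s × r s` leave the kernel invariant, which means that
`r s` induces a self-map of `Y`; the induced maps inherit all the properties of the skeleton, since
continuous Hausdorff images of compact metrizable spaces are metrizable
(`metrizableSpace_range_of_compactSpace`).

Countable products and finite sums carry coordinatewise skeletons. In a one-point modification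
`Z`, every neighbourhood of the added point contains all but finitely many summands
(`IsOnePointCountablyCompactModification.finite_not_subset`). The skeleton on `Z` retracts
countably many summands by members of their own skeletons and collapses all others to the added
point.
-/

open TopologicalSpace

/-! ### Continuous images of compact second countable spaces -/

/-- A Hausdorff continuous image of a compact second countable space is second countable: the sets
`(f '' Vᶜ)ᶜ`, with `V` a finite union of members of a countable basis, form a basis. -/
theorem secondCountableTopology_of_continuous_surjective {K : Type*} {L : Type*}
    [TopologicalSpace K] [TopologicalSpace L] [CompactSpace K] [SecondCountableTopology K]
    [T2Space L] {f : K → L} (hf : Continuous f) (hs : Function.Surjective f) :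
    SecondCountableTopology L := by
  have hb := isBasis_countableBasis K
  have hc := countable_countableBasis K
  set b := countableBasis K
  let V : Set (Set K) → Set L := fun F => (f '' (⋃₀ F)ᶜ)ᶜ
  have hV : IsTopologicalBasis (V '' {F | F.Finite ∧ F ⊆ b}) := by
    refine isTopologicalBasis_of_isOpen_of_nhds ?_ ?_
    · rintro _ ⟨F, ⟨-, hF⟩, rfl⟩
      have ho : IsOpen (⋃₀ F) := isOpen_sUnion fun U hU => hb.isOpen (hF hU)
      exact (hf.isClosedMap _ ho.isClosed_compl).isOpen_compl
    · intro y U hy hU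
      have hcomp : IsCompact (f ⁻¹' {y}) := (isClosed_singleton.preimage hf).isCompact
      obtain ⟨F, hFsub, hFfin, hFc⟩ := hcomp.elim_finite_subcover_image
        (b := {W | W ∈ b ∧ W ⊆ f ⁻¹' U}) (c := id) (fun W hW => hb.isOpen hW.1) (by
          intro x hx
          have hxU : x ∈ f ⁻¹' U := by
            have hxy : f x = y := hx
            simpa [hxy] using hy
          obtain ⟨W, hW, hxW, hWU⟩ := hb.exists_subset_of_mem_open hxU (hU.preimage hf)
          exact mem_biUnion (show W ∈ {W | W ∈ b ∧ W ⊆ f ⁻¹' U} from ⟨hW, hWU⟩) hxW)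
      refine ⟨V F, ⟨F, ⟨hFfin, fun W hW => (hFsub hW).1⟩, rfl⟩, ?_, ?_⟩
      · rintro ⟨x, hx, hxy⟩
        obtain ⟨W, hW, hxW⟩ := mem_iUnion₂.1 (hFc (show x ∈ f ⁻¹' {y} from hxy))
        exact hx ⟨W, hW, hxW⟩
      · intro z hz
        obtain ⟨x, rfl⟩ := hs z
        by_contra hzU
        refine hz ⟨x, ?_, rfl⟩
        rintro ⟨W, hW, hxW⟩
        exact hzU ((hFsub hW).2 hxW)
  exact hV.secondCountableTopology ((countable_ofPred_finite_subset hc).image V)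

theorem metrizableSpace_range_of_compactSpace {K : Type*} {L : Type*} [TopologicalSpace K]
    [TopologicalSpace L] [CompactSpace K] [SecondCountableTopology K] [T2Space L] {f : K → L}
    (hf : Continuous f) : MetrizableSpace (range f) := by
  have : CompactSpace (range f) := isCompact_iff_compactSpace.1 (isCompact_range hf)
  have := secondCountableTopology_of_continuous_surjective (f := rangeFactorization f)
    (hf.subtype_mk _) rangeFactorization_surjective
  infer_instance

/-! ### Full retractional skeletons -/

/-- A full retractional skeleton, with fullness stated as: every point is fixed by some `r s`.
Idempotence of the `r s` is the case `s = t` of `comp_eq_left`, and the convergence of the net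
`r s x` to `x` follows from fullness, since that net is eventually constant. -/
structure IsFullSkeleton {X : Type u} [TopologicalSpace X] {Γ : Type v} [PartialOrder Γ]
    (r : Γ → X → X) : Prop where
  nonempty : Nonempty Γ
  directed : ∀ s t : Γ, ∃ p : Γ, s ≤ p ∧ t ≤ p
  continuous : ∀ s, Continuous (r s)
  isCompact_range : ∀ s, IsCompact (range (r s))
  metrizable_range : ∀ s, MetrizableSpace (range (r s))
  comp_eq_left : ∀ s t, s ≤ t → ∀ x, r t (r s x) = r s x
  comp_eq_right : ∀ s t, s ≤ t → ∀ x, r s (r t x) = r s x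
  exists_sup : ∀ s : ℕ → Γ, Monotone s → ∃ t : Γ, IsLUB (range s) t ∧
    ∀ x : X, Tendsto (fun n => r (s n) x) atTop (𝓝 (r t x))
  exists_fixed : ∀ x, ∃ s, r s x = x

namespace IsFullSkeleton

variable {X : Type u} [TopologicalSpace X] {Γ : Type v} [PartialOrder Γ] {r : Γ → X → X}

theorem fixed_mono (h : IsFullSkeleton r) {s t : Γ} (hst : s ≤ t) {x : X} (hx : r s x = x) :
    r t x = x := by
  have := h.comp_eq_left s t hst x
  rwa [hx] at this

theorem fixed_of_mem_range (h : IsFullSkeleton r) {s : Γ} {x : X} (hx : x ∈ range (r s)) :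
    r s x = x := by
  obtain ⟨y, rfl⟩ := hx
  exact h.comp_eq_left s s le_rfl y

/-- Countable sets are fixed pointwise by arbitrarily large members of the skeleton. -/
theorem exists_ge_fixed_of_countable (h : IsFullSkeleton r) (s : Γ) {C : Set X}
    (hC : C.Countable) : ∃ t, s ≤ t ∧ ∀ x ∈ C, r t x = x := by
  rcases C.eq_empty_or_nonempty with rfl | hne
  · exact ⟨s, le_rfl, by simp⟩
  obtain ⟨x, rfl⟩ := hC.exists_eq_range hne
  choose g hg using h.exists_fixed
  choose p hp using h.directed
  let u : ℕ → Γ := fun n => Nat.rec s (fun k q => p q (g (x k))) n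
  have hu : Monotone u := monotone_nat_of_le_succ fun n => (hp (u n) (g (x n))).1
  obtain ⟨t, ht, -⟩ := h.exists_sup u hu
  refine ⟨t, ht.1 ⟨0, rfl⟩, ?_⟩
  rintro _ ⟨n, rfl⟩
  exact h.fixed_mono ((hp (u n) (g (x n))).2.trans (ht.1 ⟨n + 1, rfl⟩)) (hg (x n))

/-- Every sequence lies in one of the compact ranges. -/
theorem countablyCompactSpace (h : IsFullSkeleton r) : CountablyCompactSpace X := by
  rw [← isCountablyCompact_univ_iff, isCountablyCompact_iff_seq_clusterPt]
  intro x _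
  obtain ⟨s⟩ := h.nonempty
  obtain ⟨t, -, ht⟩ := h.exists_ge_fixed_of_countable s (countable_range x)
  obtain ⟨a, -, ha⟩ := (isCountablyCompact_iff_seq_clusterPt.1
    (h.isCompact_range t).isCountablyCompact) x
    (Eventually.of_forall fun n => ⟨x n, ht _ ⟨n, rfl⟩⟩)
  exact ⟨a, mem_univ _, ha⟩

theorem isNoncommCorson {Γ : Type u} [PartialOrder Γ] {r : Γ → X → X} (h : IsFullSkeleton r)
    [T35Space X] : IsNoncommCorson X where
  t35Space := inferInstance
  countablyCompactSpace := h.countablyCompactSpace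
  hasFullRetractionalSkeleton := by
    refine ⟨Γ, inferInstance, r, ⟨h.nonempty, h.directed, h.continuous,
      fun s => funext (h.comp_eq_left s s le_rfl), h.isCompact_range, h.metrizable_range,
      fun s t hst => funext fun x => (h.comp_eq_left s t hst x).symm,
      fun s t hst => funext fun x => (h.comp_eq_right s t hst x).symm, h.exists_sup,
      fun x => ?_⟩, ?_⟩
    · obtain ⟨s, hs⟩ := h.exists_fixed x
      refine tendsto_const_nhds.congr' ?_
      have := h.nonempty
      have : IsDirectedOrder Γ := ⟨h.directed⟩
      filter_upwards [eventually_ge_atTop s] with t hst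
      exact (h.fixed_mono hst hs).symm
    · refine eq_univ_of_forall fun x => ?_
      obtain ⟨s, hs⟩ := h.exists_fixed x
      exact mem_iUnion.2 ⟨s, x, hs⟩

end IsFullSkeleton

theorem IsNoncommCorson.exists_isFullSkeleton {X : Type u} [TopologicalSpace X]
    (h : IsNoncommCorson X) :
    ∃ (Γ : Type u) (_ : PartialOrder Γ) (r : Γ → X → X), IsFullSkeleton r := by
  obtain ⟨Γ, _, r, hr, hfull⟩ := h.hasFullRetractionalSkeleton
  refine ⟨Γ, inferInstance, r, hr.nonempty, hr.directed, hr.continuous, hr.isCompact_range,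
    hr.metrizable_range, fun s t hst x => (congrFun (hr.comp_eq_left s t hst) x).symm,
    fun s t hst x => (congrFun (hr.comp_eq_right s t hst) x).symm, hr.exists_sup, fun x => ?_⟩
  obtain ⟨s, y, rfl⟩ := mem_iUnion.1 (hfull.symm ▸ mem_univ x : x ∈ inducedSet r)
  exact ⟨s, congrFun (hr.retraction s) y⟩

namespace IsFullSkeleton

variable {X : Type u} [TopologicalSpace X] {Γ : Type v} [PartialOrder Γ] {r : Γ → X → X}

/-- A cofinal set of indices that is closed under suprema of increasing sequences still indexes a
full skeleton. -/
theorem restrict_index (h : IsFullSkeleton r) (P : Γ → Prop) (hcof : ∀ s, ∃ t, s ≤ t ∧ P t)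
    (hsup : ∀ (s : ℕ → Γ) (t : Γ), (∀ n, P (s n)) →
      (∀ x, Tendsto (fun n => r (s n) x) atTop (𝓝 (r t x))) → P t) :
    IsFullSkeleton fun s : {t // P t} => r s where
  nonempty := by
    obtain ⟨s⟩ := h.nonempty
    obtain ⟨t, -, ht⟩ := hcof s
    exact ⟨⟨t, ht⟩⟩
  directed s t := by
    obtain ⟨p, hs, ht⟩ := h.directed s t
    obtain ⟨q, hpq, hq⟩ := hcof p
    exact ⟨⟨q, hq⟩, hs.trans hpq, ht.trans hpq⟩
  continuous s := h.continuous s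
  isCompact_range s := h.isCompact_range s
  metrizable_range s := h.metrizable_range s
  comp_eq_left s t hst := h.comp_eq_left s t hst
  comp_eq_right s t hst := h.comp_eq_right s t hst
  exists_sup s hs := by
    obtain ⟨t, ht, hlim⟩ := h.exists_sup (fun n => (s n : Γ)) hs
    refine ⟨⟨t, hsup _ t (fun n => (s n).2) hlim⟩, ⟨?_, fun q hq => ht.2 ?_⟩, hlim⟩
    · rintro _ ⟨n, rfl⟩
      exact ht.1 ⟨n, rfl⟩
    · rintro _ ⟨n, rfl⟩
      exact hq ⟨n, rfl⟩
  exists_fixed x := by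
    obtain ⟨s, hs⟩ := h.exists_fixed x
    obtain ⟨t, hst, ht⟩ := hcof s
    exact ⟨⟨t, ht⟩, h.fixed_mono hst hs⟩

/-! ### Countably closed subspaces -/

/-- Subsets of the metrizable compact set `range (r s)` are separable. -/
theorem exists_countable_subset_image_dense (h : IsFullSkeleton r) (s : Γ) (Y : Set X) :
    ∃ C ⊆ Y, C.Countable ∧ r s '' Y ⊆ closure (r s '' C) := by
  have := h.metrizable_range s
  have : CompactSpace (range (r s)) := isCompact_iff_compactSpace.1 (h.isCompact_range s)
  let φ : X → range (r s) := rangeFactorization (r s)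
  obtain ⟨D, hDsub, hDc, hD⟩ :=
    (IsSeparable.of_separableSpace (φ '' Y)).exists_countable_dense_subset
  obtain ⟨C, hCY, hC⟩ := SurjOn.exists_bijOn_subset (f := φ) (s := Y) (t := D) hDsub
  refine ⟨C, hCY, hC.mapsTo.countable_of_injOn hC.injOn hDc, ?_⟩
  rintro _ ⟨y, hy, rfl⟩
  have hφD : (fun z : range (r s) => (z : X)) '' D ⊆ r s '' C := by
    rintro _ ⟨d, hd, rfl⟩
    obtain ⟨c, hc, rfl⟩ := hC.surjOn hd
    exact ⟨c, hc, rfl⟩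
  exact closure_mono hφD (image_closure_subset_closure_image continuous_subtype_val
    ⟨φ y, hD ⟨y, hy, rfl⟩, rfl⟩)

/-- Arbitrarily large members of a full skeleton leave a given countably closed set invariant.
An increasing sequence `s n` is built together with countable sets `C (s n) ⊆ Y` whose images
under `r (s n)` are dense in `r (s n) '' Y` and which are fixed by `r (s (n + 1))`; the supremum
`t` of the sequence maps `Y` into the compact set `closure (⋃ n, C (s n)) ⊆ Y`. -/
theorem exists_ge_mapsTo [T2Space X] (h : IsFullSkeleton r) {Y : Set X}
    (hY : IsCountablyClosed Y) (s₀ : Γ) : ∃ t, s₀ ≤ t ∧ MapsTo (r t) Y Y := by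
  choose C hCY hCc hCd using fun s => h.exists_countable_subset_image_dense s Y
  choose next hle hfix using fun s => h.exists_ge_fixed_of_countable s (hCc s)
  let s : ℕ → Γ := fun n => next^[n] s₀
  have hsucc : ∀ n, s (n + 1) = next (s n) := fun n => Function.iterate_succ_apply' next n s₀
  have hs : Monotone s := monotone_nat_of_le_succ fun n => (hle (s n)).trans_eq (hsucc n).symm
  obtain ⟨t, ht, hlim⟩ := h.exists_sup s hs
  have hst : ∀ n, s n ≤ t := fun n => ht.1 ⟨n, rfl⟩
  refine ⟨t, hst 0, ?_⟩
  let K := closure (⋃ n, C (s n))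
  have hKY : K ⊆ Y := hY _ (iUnion_subset fun n => hCY _) (countable_iUnion fun n => hCc _)
  have hKt : K ⊆ range (r t) := by
    refine closure_minimal (iUnion_subset fun n x hx => ⟨x, ?_⟩) (h.isCompact_range t).isClosed
    exact h.fixed_mono (hst (n + 1)) (hsucc n ▸ hfix (s n) x hx)
  have hK : IsCompact K := (h.isCompact_range t).of_isClosed_subset isClosed_closure hKt
  intro y hy
  suffices r t y ∈ K from hKY this
  -- By compactness some `k ∈ K` has the same image as `y` under all `r (s n)`; in the limit,
  -- `k = r t k = r t y`.
  let F : ℕ → Set X := fun n => K ∩ {k | r (s n) k = r (s n) y}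
  have hclosed : ∀ n, IsClosed (F n) := fun n =>
    isClosed_closure.inter (isClosed_eq (h.continuous _) continuous_const)
  have hanti : ∀ m n, m ≤ n → F n ⊆ F m := by
    rintro m n hmn k ⟨hk, hkn⟩
    refine ⟨hk, ?_⟩
    have hkn' : r (s n) k = r (s n) y := hkn
    change r (s m) k = r (s m) y
    rw [← h.comp_eq_right _ _ (hs hmn) k, ← h.comp_eq_right _ _ (hs hmn) y, hkn']
  have hne : ∀ n, (F n).Nonempty := by
    intro n
    have hsub : closure (r (s n) '' C (s n)) ⊆ r (s n) '' K :=
      closure_minimal (image_mono ((subset_iUnion (fun n => C (s n)) n).trans subset_closure))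
        (hK.image (h.continuous _)).isClosed
    obtain ⟨k, hk, hky⟩ := hsub (hCd (s n) ⟨y, hy, rfl⟩)
    exact ⟨k, hk, hky⟩
  obtain ⟨k, hk⟩ := IsCompact.nonempty_iInter_of_sequence_nonempty_isCompact_isClosed F
    (fun n => hanti n (n + 1) n.le_succ) hne (hK.inter_right
      (isClosed_eq (h.continuous _) continuous_const)) hclosed
  have hk' := mem_iInter.1 hk
  have hlimk := hlim k
  rw [h.fixed_of_mem_range (hKt (hk' 0).1)] at hlimk
  have heq : r t y = k :=
    tendsto_nhds_unique (hlim y) (hlimk.congr fun n => (hk' n).2)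
  exact heq ▸ (hk' 0).1

theorem mem_of_tendsto_of_isCountablyClosed {Y : Set X} (hY : IsCountablyClosed Y) {y : ℕ → X}
    (hy : ∀ n, y n ∈ Y) {a : X} (ha : Tendsto y atTop (𝓝 a)) : a ∈ Y :=
  hY (range y) (range_subset_iff.2 hy) (countable_range y)
    (mem_closure_of_tendsto ha (Eventually.of_forall fun n => ⟨n, rfl⟩))

theorem restrict_mapsTo [T2Space X] (h : IsFullSkeleton r) {Y : Set X}
    (hY : IsCountablyClosed Y) :
    IsFullSkeleton fun s : {t // MapsTo (r t) Y Y} => r s :=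
  h.restrict_index (fun t => MapsTo (r t) Y Y) (h.exists_ge_mapsTo hY)
    fun _ _ hs hlim y hy => mem_of_tendsto_of_isCountablyClosed hY (fun n => hs n hy) (hlim y)

theorem subspace [T2Space X] (h : IsFullSkeleton r) {Y : Set X} (hY : IsCountablyClosed Y)
    (hr : ∀ s, MapsTo (r s) Y Y) : IsFullSkeleton fun s => (hr s).restrict (r s) Y Y := by
  have hrange : ∀ s, (fun y : Y => (y : X)) '' range ((hr s).restrict (r s) Y Y) =
      range (r s) ∩ Y := by
    intro s
    ext x
    constructor
    · rintro ⟨_, ⟨y, rfl⟩, rfl⟩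
      exact ⟨⟨y, rfl⟩, hr s y.2⟩
    · rintro ⟨hx, hxY⟩
      exact ⟨⟨x, hxY⟩, ⟨⟨x, hxY⟩, Subtype.ext (h.fixed_of_mem_range hx)⟩, rfl⟩
  refine ⟨h.nonempty, h.directed, fun s => (h.continuous s).restrict (hr s), fun s => ?_,
    fun s => ?_, fun s t hst x => Subtype.ext (h.comp_eq_left s t hst x),
    fun s t hst x => Subtype.ext (h.comp_eq_right s t hst x), fun s hs => ?_, fun x => ?_⟩
  · rw [Subtype.isCompact_iff, hrange]
    refine (h.isCompact_range s).of_isClosed_subset ?_ inter_subset_left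
    -- In the metrizable space `range (r s)` it suffices to check sequential closedness.
    have := h.metrizable_range s
    have hc : IsClosed {z : range (r s) | (z : X) ∈ Y} :=
      IsSeqClosed.isClosed fun y a hy ha => mem_of_tendsto_of_isCountablyClosed hY hy
        ((continuous_subtype_val.tendsto a).comp ha)
    have := (h.isCompact_range s).isClosed.isClosedEmbedding_subtypeVal.isClosedMap _ hc
    convert this using 1
    ext x
    simp [and_comm]
  · have := h.metrizable_range s
    have hval : IsEmbedding fun z : range ((hr s).restrict (r s) Y Y) => ((z : Y) : X) :=
      IsEmbedding.subtypeVal.comp IsEmbedding.subtypeVal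
    have hemb : IsEmbedding fun z : range ((hr s).restrict (r s) Y Y) =>
        (⟨(z : Y), (hrange s ▸ mem_image_of_mem _ z.2 : (z : Y).1 ∈ range (r s) ∩ Y).1⟩ :
          range (r s)) :=
      IsEmbedding.of_comp (by fun_prop) continuous_subtype_val hval
    exact hemb.metrizableSpace
  · obtain ⟨t, ht, hlim⟩ := h.exists_sup s hs
    exact ⟨t, ht, fun x => tendsto_subtype_rng.2 (hlim x)⟩
  · obtain ⟨s, hs⟩ := h.exists_fixed x
    exact ⟨s, Subtype.ext hs⟩

end IsFullSkeleton

theorem IsNoncommCorson.of_isCountablyClosed {X : Type u} [TopologicalSpace X] {Y : Set X}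
    (hX : IsNoncommCorson X) (hY : IsCountablyClosed Y) : IsNoncommCorson Y := by
  have := hX.t35Space
  obtain ⟨Γ, _, r, h⟩ := hX.exists_isFullSkeleton
  exact ((h.restrict_mapsTo hY).subspace hY fun s => s.2).isNoncommCorson

/-! ### Quotients -/

namespace IsFullSkeleton

variable {X : Type u} [TopologicalSpace X] {Γ : Type v} [PartialOrder Γ] {r : Γ → X → X}

theorem prod_self [T2Space X] (h : IsFullSkeleton r) :
    IsFullSkeleton fun s => Prod.map (r s) (r s) where
  nonempty := h.nonempty
  directed := h.directed
  continuous s := (h.continuous s).prodMap (h.continuous s)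
  isCompact_range s := by
    rw [range_prodMap]
    exact (h.isCompact_range s).prod (h.isCompact_range s)
  metrizable_range s := by
    have := h.metrizable_range s
    have : CompactSpace (range (r s)) := isCompact_iff_compactSpace.1 (h.isCompact_range s)
    have hr : range (Prod.map (r s) (r s)) =
        range (Prod.map ((↑) : range (r s) → X) ((↑) : range (r s) → X)) := by
      rw [range_prodMap, range_prodMap, Subtype.range_coe]
    rw [hr]
    exact metrizableSpace_range_of_compactSpace
      (continuous_subtype_val.prodMap continuous_subtype_val)
  comp_eq_left s t hst x := Prod.ext (h.comp_eq_left s t hst _) (h.comp_eq_left s t hst _)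
  comp_eq_right s t hst x := Prod.ext (h.comp_eq_right s t hst _) (h.comp_eq_right s t hst _)
  exists_sup s hs := by
    obtain ⟨t, ht, hlim⟩ := h.exists_sup s hs
    exact ⟨t, ht, fun x => (hlim x.1).prodMk_nhds (hlim x.2)⟩
  exists_fixed x := by
    obtain ⟨s, hs⟩ := h.exists_fixed x.1
    obtain ⟨t, ht⟩ := h.exists_fixed x.2
    obtain ⟨p, hsp, htp⟩ := h.directed s t
    exact ⟨p, Prod.ext (h.fixed_mono hsp hs) (h.fixed_mono htp ht)⟩

/-- A full skeleton compatible with the fibres of a quotient map descends to the quotient. -/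
theorem descend {Y : Type*} [TopologicalSpace Y] [T2Space Y] (h : IsFullSkeleton r) {f : X → Y}
    (hf : IsQuotientMap f) {R : Γ → Y → Y} (hR : ∀ s x, R s (f x) = f (r s x)) :
    IsFullSkeleton R := by
  have hrange : ∀ s, range (R s) = range fun z : range (r s) => f z := by
    intro s
    ext y
    constructor
    · rintro ⟨y, rfl⟩
      obtain ⟨x, rfl⟩ := hf.surjective y
      exact ⟨⟨r s x, x, rfl⟩, (hR s x).symm⟩
    · rintro ⟨⟨_, x, rfl⟩, rfl⟩
      exact ⟨f x, hR s x⟩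
  have hcont : ∀ s, Continuous fun z : range (r s) => f z := fun s =>
    hf.continuous.comp continuous_subtype_val
  refine ⟨h.nonempty, h.directed, fun s => ?_, fun s => ?_, fun s => ?_, fun s t hst y => ?_,
    fun s t hst y => ?_, fun s hs => ?_, fun y => ?_⟩
  · rw [hf.continuous_iff]
    exact (hf.continuous.comp (h.continuous s)).congr fun x => (hR s x).symm
  · have : CompactSpace (range (r s)) := isCompact_iff_compactSpace.1 (h.isCompact_range s)
    rw [hrange]
    exact _root_.isCompact_range (hcont s)
  · have := h.metrizable_range s
    have : CompactSpace (range (r s)) := isCompact_iff_compactSpace.1 (h.isCompact_range s)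
    rw [hrange]
    exact metrizableSpace_range_of_compactSpace (hcont s)
  · obtain ⟨x, rfl⟩ := hf.surjective y
    rw [hR, hR, h.comp_eq_left s t hst]
  · obtain ⟨x, rfl⟩ := hf.surjective y
    rw [hR, hR, hR, h.comp_eq_right s t hst]
  · obtain ⟨t, ht, hlim⟩ := h.exists_sup s hs
    refine ⟨t, ht, fun y => ?_⟩
    obtain ⟨x, rfl⟩ := hf.surjective y
    simp only [hR]
    exact (hf.continuous.tendsto _).comp (hlim x)
  · obtain ⟨x, rfl⟩ := hf.surjective y
    obtain ⟨s, hs⟩ := h.exists_fixed x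
    exact ⟨s, by rw [hR, hs]⟩

end IsFullSkeleton

/-- The kernel `{p | f p.1 = f p.2}` of a quotient map is closed in `X × X`, so cofinally many
retractions `r s × r s` leave it invariant, which says that `r s` descends to the quotient. -/
theorem IsNoncommCorson.of_isQuotientMap {X : Type u} {Y : Type u} [TopologicalSpace X]
    [TopologicalSpace Y] [T35Space Y] {f : X → Y} (hX : IsNoncommCorson X)
    (hf : IsQuotientMap f) : IsNoncommCorson Y := by
  have := hX.t35Space
  obtain ⟨Γ, _, r, h⟩ := hX.exists_isFullSkeleton
  let E : Set (X × X) := {p | f p.1 = f p.2}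
  have hE : IsClosed E := isClosed_eq (hf.continuous.comp continuous_fst)
    (hf.continuous.comp continuous_snd)
  have hE' : IsCountablyClosed E := fun C hC _ => closure_minimal hC hE
  have h' := h.restrict_index (fun t => MapsTo (Prod.map (r t) (r t)) E E)
    (h.prod_self.exists_ge_mapsTo hE')
    fun s t hs hlim p hp => hE.mem_of_tendsto ((hlim p.1).prodMk_nhds (hlim p.2))
      (Eventually.of_forall fun n => hs n hp)
  choose g hg using hf.surjective
  refine (h'.descend hf (R := fun s y => f (r s (g y))) fun s x => ?_).isNoncommCorson
  exact s.2 (show (g (f x), x) ∈ E from hg (f x))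

/-! ### Countable products and finite sums -/

/-- Suprema of increasing sequences in a product of posets are taken coordinatewise. -/
theorem isLUB_range_pi {ι : Type*} {Γ : ι → Type*} [∀ i, PartialOrder (Γ i)]
    {s : ℕ → ∀ i, Γ i} {t : ∀ i, Γ i} (ht : ∀ i, IsLUB (range fun n => s n i) (t i)) :
    IsLUB (range s) t := by
  refine isLUB_pi.2 fun i => ?_
  rw [← range_comp]
  exact ht i

theorem IsNoncommCorson.pi {ι : Type v} [Countable ι] {X : ι → Type u}
    [∀ i, TopologicalSpace (X i)] (hX : ∀ i, IsNoncommCorson (X i)) :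
    IsNoncommCorson (∀ i, X i) := by
  have := fun i => (hX i).t35Space
  choose Γ inst r h using fun i => (hX i).exists_isFullSkeleton
  have hr : IsFullSkeleton fun (s : ∀ i, Γ i) (x : ∀ i, X i) i => r i (s i) (x i) := by
    have hrange : ∀ s : ∀ i, Γ i, range (fun (x : ∀ i, X i) i => r i (s i) (x i)) =
        range fun (z : ∀ i, range (r i (s i))) i => (z i : X i) := by
      intro s
      ext y
      constructor
      · rintro ⟨x, rfl⟩
        exact ⟨fun i => ⟨_, x i, rfl⟩, rfl⟩
      · rintro ⟨z, rfl⟩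
        exact ⟨fun i => z i, funext fun i => (h i).fixed_of_mem_range (z i).2⟩
    have hcont : ∀ s : ∀ i, Γ i,
        Continuous fun (z : ∀ i, range (r i (s i))) i => (z i : X i) := fun s => by fun_prop
    have hcomp : ∀ (s : ∀ i, Γ i) i, CompactSpace (range (r i (s i))) := fun s i =>
      isCompact_iff_compactSpace.1 ((h i).isCompact_range (s i))
    refine ⟨⟨fun i => (h i).nonempty.some⟩, fun s t => ?_,
      fun s => continuous_pi fun i => ((h i).continuous _).comp (continuous_apply i),
      fun s => ?_, fun s => ?_, fun s t hst x => funext fun i => (h i).comp_eq_left _ _ (hst i) _,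
      fun s t hst x => funext fun i => (h i).comp_eq_right _ _ (hst i) _, fun s hs => ?_,
      fun x => ?_⟩
    · choose p hp using fun i => (h i).directed (s i) (t i)
      exact ⟨p, fun i => (hp i).1, fun i => (hp i).2⟩
    · rw [hrange]
      exact isCompact_range (hcont s)
    · have := fun i => (h i).metrizable_range (s i)
      rw [hrange]
      exact metrizableSpace_range_of_compactSpace (hcont s)
    · choose t ht hlim using fun i => (h i).exists_sup (fun n => s n i) fun m n hmn => hs hmn i
      exact ⟨t, isLUB_range_pi ht, fun x => tendsto_pi_nhds.2 fun i => hlim i (x i)⟩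
    · choose s hs using fun i => (h i).exists_fixed (x i)
      exact ⟨s, funext hs⟩
  exact hr.isNoncommCorson

theorem t35Space_sigma {ι : Type*} {X : ι → Type*} [∀ i, TopologicalSpace (X i)]
    [∀ i, T35Space (X i)] : T35Space (Σ i, X i) := by
  classical
  refine { completely_regular := ?_ }
  rintro ⟨i, x⟩ K hK hx
  obtain ⟨f, hf, hfx, hfK⟩ := CompletelyRegularSpace.completely_regular x (Sigma.mk i ⁻¹' K)
    (hK.preimage continuous_sigmaMk) hx
  refine ⟨fun p => if hp : p.1 = i then f (hp ▸ p.2) else 1, continuous_sigma fun j => ?_, ?_, ?_⟩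
  · by_cases hj : j = i
    · subst hj
      simpa using hf
    · simpa [hj] using continuous_const
  · simpa using hfx
  · rintro ⟨j, y⟩ hy
    by_cases hj : j = i
    · subst hj
      simpa using hfK hy
    · simp [hj]

theorem IsNoncommCorson.sigma {ι : Type v} [Finite ι] {X : ι → Type u}
    [∀ i, TopologicalSpace (X i)] (hX : ∀ i, IsNoncommCorson (X i)) :
    IsNoncommCorson (Σ i, X i) := by
  have := fun i => (hX i).t35Space
  choose Γ inst r h using fun i => (hX i).exists_isFullSkeleton
  have hr : IsFullSkeleton fun (s : ∀ i, Γ i) (x : Σ i, X i) =>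
      (⟨x.1, r x.1 (s x.1) x.2⟩ : Σ i, X i) := by
    have hrange : ∀ s : ∀ i, Γ i,
        range (fun x : Σ i, X i => (⟨x.1, r x.1 (s x.1) x.2⟩ : Σ i, X i)) =
        range fun z : Σ i, range (r i (s i)) => (⟨z.1, z.2⟩ : Σ i, X i) := by
      intro s
      ext y
      constructor
      · rintro ⟨⟨i, x⟩, rfl⟩
        exact ⟨⟨i, _, x, rfl⟩, rfl⟩
      · rintro ⟨⟨i, _, x, rfl⟩, rfl⟩
        exact ⟨⟨i, x⟩, rfl⟩
    have hcont : ∀ s : ∀ i, Γ i,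
        Continuous fun z : Σ i, range (r i (s i)) => (⟨z.1, z.2⟩ : Σ i, X i) := fun s =>
      continuous_sigma fun i => continuous_sigmaMk.comp continuous_subtype_val
    have hcomp : ∀ (s : ∀ i, Γ i) i, CompactSpace (range (r i (s i))) := fun s i =>
      isCompact_iff_compactSpace.1 ((h i).isCompact_range (s i))
    refine ⟨⟨fun i => (h i).nonempty.some⟩, fun s t => ?_,
      fun s => continuous_sigma fun i => continuous_sigmaMk.comp ((h i).continuous (s i)),
      fun s => ?_, fun s => ?_,
      fun s t hst x => congrArg (Sigma.mk x.1) ((h _).comp_eq_left _ _ (hst _) _),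
      fun s t hst x => congrArg (Sigma.mk x.1) ((h _).comp_eq_right _ _ (hst _) _),
      fun s hs => ?_, ?_⟩
    · choose p hp using fun i => (h i).directed (s i) (t i)
      exact ⟨p, fun i => (hp i).1, fun i => (hp i).2⟩
    · rw [hrange]
      exact isCompact_range (hcont s)
    · have := fun i => (h i).metrizable_range (s i)
      rw [hrange]
      exact metrizableSpace_range_of_compactSpace (hcont s)
    · choose t ht hlim using fun i => (h i).exists_sup (fun n => s n i) fun m n hmn => hs hmn i
      exact ⟨t, isLUB_range_pi ht, fun x =>
        (continuous_sigmaMk.tendsto _).comp (hlim x.1 x.2)⟩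
    · rintro ⟨i, x⟩
      classical
      obtain ⟨g, hg⟩ := (h i).exists_fixed x
      refine ⟨Function.update (fun j => (h j).nonempty.some) i g, ?_⟩
      simp [hg]
  have := t35Space_sigma (X := X)
  exact hr.isNoncommCorson

/-! ### One-point modifications of topological sums -/
/-- The supremum in `WithBot Γ` of a sequence that eventually takes values in `Γ`. -/
theorem isLUB_range_withBot_coe {Γ : Type*} [PartialOrder Γ] {σ : ℕ → WithBot Γ}
    {N : ℕ} {u : ℕ → Γ} {τ : Γ} (hσ : Monotone σ) (hu : ∀ n, σ (n + N) = u n)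
    (hτ : IsLUB (range u) τ) : IsLUB (range σ) (τ : WithBot Γ) := by
  constructor
  · rintro _ ⟨n, rfl⟩
    refine (hσ (Nat.le_add_right n N)).trans ?_
    rw [hu]
    exact WithBot.coe_le_coe.2 (hτ.1 ⟨n, rfl⟩)
  · intro q hq
    induction q with
    | bot =>
      have := hq ⟨0 + N, rfl⟩
      rw [hu] at this
      exact absurd this (WithBot.not_coe_le_bot _)
    | coe q =>
      refine WithBot.coe_le_coe.2 (hτ.2 ?_)
      rintro _ ⟨n, rfl⟩
      rw [← WithBot.coe_le_coe, ← hu]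
      exact hq ⟨n + N, rfl⟩

namespace IsOnePointCountablyCompactModification

variable {A : Type v} {X : A → Type u} [∀ a, TopologicalSpace (X a)] {Z : Type (max u v)}
  [TopologicalSpace Z] {e : ∀ a, X a → Z} {infty : Z}

theorem apply_ne_infty (hZ : IsOnePointCountablyCompactModification X Z e infty) {a : A}
    (x : X a) : e a x ≠ infty := by
  have : e a x ∈ ({infty}ᶜ : Set Z) := hZ.iUnion_range ▸ mem_iUnion.2 ⟨a, x, rfl⟩
  exact this

theorem eq_infty_or_exists (hZ : IsOnePointCountablyCompactModification X Z e infty) (z : Z) :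
    z = infty ∨ ∃ a x, z = e a x := by
  by_cases hz : z = infty
  · exact Or.inl hz
  · have : z ∈ ⋃ a, range (e a) := hZ.iUnion_range ▸ hz
    obtain ⟨a, x, rfl⟩ := mem_iUnion.1 this
    exact Or.inr ⟨a, x, rfl⟩

theorem eq_of_mem_range (hZ : IsOnePointCountablyCompactModification X Z e infty) {a b : A} {z : Z}
    (ha : z ∈ range (e a)) (hb : z ∈ range (e b)) : a = b := by
  by_contra hab
  exact (disjoint_left.1 (hZ.disjoint a b hab)) ha hb

theorem injective_sigma (hZ : IsOnePointCountablyCompactModification X Z e infty) :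
    Function.Injective fun p : Σ a, X a => e p.1 p.2 := by
  rintro ⟨a, x⟩ ⟨b, y⟩ hxy
  have hxy' : e a x = e b y := hxy
  obtain rfl := hZ.eq_of_mem_range (a := a) (b := b) (z := e a x) ⟨x, rfl⟩ ⟨y, hxy'.symm⟩
  rw [(hZ.isEmbedding a).injective hxy']

/-- By countable compactness, points chosen in infinitely many summands accumulate, and they can
only accumulate at the added point. -/
theorem finite_not_subset (hZ : IsOnePointCountablyCompactModification X Z e infty) {U : Set Z}
    (hU : U ∈ 𝓝 infty) : {a | ¬ range (e a) ⊆ U}.Finite := by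
  by_contra hinf
  let a := Set.Infinite.natEmbedding _ hinf
  choose z hz hzU using fun n => not_subset.1 (a n).2
  have := hZ.countablyCompactSpace
  obtain ⟨w, -, hw⟩ := (isCountablyCompact_iff_seq_clusterPt.1 (isCountablyCompact_univ_iff.2 this))
    z (Eventually.of_forall fun _ => mem_univ _)
  rcases hZ.eq_infty_or_exists w with rfl | ⟨b, x, rfl⟩
  · obtain ⟨n, hn⟩ := (hw.frequently hU).exists
    exact hzU n hn
  · have hfreq := frequently_atTop.1
      (hw.frequently ((hZ.isClopen_range b).isOpen.mem_nhds ⟨x, rfl⟩))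
    obtain ⟨m, -, hm⟩ := hfreq 0
    obtain ⟨n, hmn, hn⟩ := hfreq (m + 1)
    have : a m = a n := Subtype.ext
      ((hZ.eq_of_mem_range (hz m) hm).trans (hZ.eq_of_mem_range (hz n) hn).symm)
    have := a.injective this
    omega

/-- The self-map of `Z` that fixes the added point and is `g a` on the summand `X a`. -/
noncomputable def glue (e : ∀ a, X a → Z) (infty : Z) (g : ∀ a, X a → Z) : Z → Z :=
  Function.extend (fun p : Σ a, X a => e p.1 p.2) (fun p => g p.1 p.2) fun _ => infty

theorem glue_apply (hZ : IsOnePointCountablyCompactModification X Z e infty) (g : ∀ a, X a → Z)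
    {a : A} (x : X a) : glue e infty g (e a x) = g a x :=
  hZ.injective_sigma.extend_apply (fun p => g p.1 p.2) (fun _ => infty) ⟨a, x⟩

theorem glue_infty (hZ : IsOnePointCountablyCompactModification X Z e infty) (g : ∀ a, X a → Z) :
    glue e infty g infty = infty :=
  Function.extend_apply' _ _ _ fun ⟨p, hp⟩ => hZ.apply_ne_infty p.2 hp

theorem range_glue (hZ : IsOnePointCountablyCompactModification X Z e infty) (g : ∀ a, X a → Z) :
    range (glue e infty g) = insert infty (⋃ a, range (g a)) := by
  ext z
  constructor
  · rintro ⟨w, rfl⟩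
    rcases hZ.eq_infty_or_exists w with rfl | ⟨a, x, rfl⟩
    · exact Or.inl (hZ.glue_infty g)
    · exact Or.inr (mem_iUnion.2 ⟨a, x, (hZ.glue_apply g x).symm⟩)
  · rintro (rfl | hz)
    · exact ⟨z, hZ.glue_infty g⟩
    · obtain ⟨a, x, rfl⟩ := mem_iUnion.1 hz
      exact ⟨e a x, hZ.glue_apply g x⟩

theorem finite_not_range_subset (hZ : IsOnePointCountablyCompactModification X Z e infty)
    {g : ∀ a, X a → Z} (hg : ∀ a, range (g a) ⊆ insert infty (range (e a))) {U : Set Z}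
    (hU : U ∈ 𝓝 infty) : {a | ¬ range (g a) ⊆ U}.Finite :=
  (hZ.finite_not_subset hU).subset fun a ha hsub =>
    ha ((hg a).trans (insert_subset (mem_of_mem_nhds hU) hsub))

theorem continuous_glue (hZ : IsOnePointCountablyCompactModification X Z e infty)
    {g : ∀ a, X a → Z} (hc : ∀ a, Continuous (g a))
    (hg : ∀ a, range (g a) ⊆ insert infty (range (e a))) : Continuous (glue e infty g) := by
  rw [continuous_iff_continuousAt]
  intro z
  rcases hZ.eq_infty_or_exists z with rfl | ⟨a, x, rfl⟩
  · intro U hU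
    rw [hZ.glue_infty] at hU
    have hF := hZ.finite_not_range_subset hg hU
    have hV : (⋃ a ∈ {a | ¬ range (g a) ⊆ U}, range (e a))ᶜ ∈ 𝓝 z :=
      (hF.isClosed_biUnion fun a _ => (hZ.isClopen_range a).isClosed).isOpen_compl.mem_nhds
        fun hmem => by
          obtain ⟨a, -, x, hx⟩ := mem_iUnion₂.1 hmem
          exact hZ.apply_ne_infty x hx
    refine mem_map.2 (mem_of_superset hV fun w hw => ?_)
    change glue e z g w ∈ U
    rcases hZ.eq_infty_or_exists w with rfl | ⟨a, x, rfl⟩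
    · rw [hZ.glue_infty]
      exact mem_of_mem_nhds hU
    · rw [hZ.glue_apply]
      by_contra hxU
      exact hw (mem_iUnion₂.2 ⟨a, fun hsub => hxU (hsub ⟨x, rfl⟩), x, rfl⟩)
  · have hopen : IsOpenEmbedding (e a) := ⟨hZ.isEmbedding a, (hZ.isClopen_range a).isOpen⟩
    rw [← hopen.continuousAt_iff]
    exact (hc a).continuousAt.congr (Eventually.of_forall fun y => (hZ.glue_apply g y).symm)

theorem isCompact_range_glue (hZ : IsOnePointCountablyCompactModification X Z e infty)
    {g : ∀ a, X a → Z} (hk : ∀ a, IsCompact (range (g a)))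
    (hg : ∀ a, range (g a) ⊆ insert infty (range (e a))) : IsCompact (range (glue e infty g)) := by
  rw [hZ.range_glue, isCompact_iff_ultrafilter_le_nhds]
  intro f hf
  by_cases hle : (f : Filter Z) ≤ 𝓝 infty
  · exact ⟨infty, mem_insert _ _, hle⟩
  obtain ⟨U, hU, hUf⟩ := not_subset.1 hle
  have hF := hZ.finite_not_range_subset hg hU
  -- Off the neighbourhood `U`, only finitely many of the compact sets `range (g a)` remain.
  have hcompact := hF.isCompact_biUnion fun a _ => hk a
  obtain ⟨z, hz, hfz⟩ := isCompact_iff_ultrafilter_le_nhds.1 hcompact f (by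
    rw [le_principal_iff]
    filter_upwards [le_principal_iff.1 hf, Ultrafilter.compl_mem_iff_notMem.2 hUf] with z hz hzU
    rcases hz with rfl | hz
    · exact absurd (mem_of_mem_nhds hU) hzU
    · obtain ⟨a, ha⟩ := mem_iUnion.1 hz
      exact mem_iUnion₂.2 ⟨a, fun hsub => hzU (hsub ha), ha⟩)
  obtain ⟨a, -, hza⟩ := mem_iUnion₂.1 hz
  exact ⟨z, Or.inr (mem_iUnion.2 ⟨a, hza⟩), hfz⟩

/-- Only countably many of the ranges are nontrivial, and for each of those the retraction that
collapses all other summands is a continuous map with metrizable range; together these maps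
separate the points of the compact set `range (glue e infty g)`. -/
theorem metrizableSpace_range_glue [T2Space Z]
    (hZ : IsOnePointCountablyCompactModification X Z e infty) {g : ∀ a, X a → Z}
    (hc : ∀ a, Continuous (g a)) (hk : ∀ a, IsCompact (range (g a)))
    (hm : ∀ a, MetrizableSpace (range (g a)))
    (hg : ∀ a, range (g a) ⊆ insert infty (range (e a)))
    (hidem : ∀ a x, glue e infty g (g a x) = g a x)
    (hcount : {a | ¬ range (g a) ⊆ {infty}}.Countable) :
    MetrizableSpace (range (glue e infty g)) := by
  classical
  let B := {a | ¬ range (g a) ⊆ {infty}}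
  have : Countable B := hcount.to_subtype
  have : CompactSpace (range (glue e infty g)) :=
    isCompact_iff_compactSpace.1 (hZ.isCompact_range_glue hk hg)
  -- `only b` collapses every summand other than `X b`.
  let only : A → ∀ a, X a → Z := fun b a => if a = b then g a else fun _ => infty
  have only_self : ∀ b, only b b = g b := fun b => if_pos rfl
  have only_ne : ∀ {a b}, a ≠ b → only b a = fun _ => infty := fun hab => if_neg hab
  have hcont : ∀ b, Continuous (glue e infty (only b)) := by
    refine fun b => hZ.continuous_glue (fun a => ?_) fun a => ?_
    · rcases eq_or_ne a b with rfl | hab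
      · rw [only_self]
        exact hc a
      · rw [only_ne hab]
        exact continuous_const
    · rcases eq_or_ne a b with rfl | hab
      · rw [only_self]
        exact hg a
      · rw [only_ne hab]
        rintro _ ⟨x, rfl⟩
        exact mem_insert _ _
  have hmet : ∀ b, MetrizableSpace (range (glue e infty (only b))) := by
    intro b
    have := hm b
    have : CompactSpace (range (g b)) := isCompact_iff_compactSpace.1 (hk b)
    have hsub : range (glue e infty (only b)) ⊆
        range (Sum.elim (fun z : range (g b) => (z : Z)) fun _ : Unit => infty) := by
      rw [hZ.range_glue, Sum.elim_range, Subtype.range_coe]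
      refine insert_subset (Or.inr ⟨(), rfl⟩) (iUnion_subset fun a => ?_)
      rcases eq_or_ne a b with rfl | hab
      · rw [only_self]
        exact subset_union_left
      · rw [only_ne hab]
        rintro _ ⟨x, rfl⟩
        exact Or.inr ⟨(), rfl⟩
    have := metrizableSpace_range_of_compactSpace
      (continuous_subtype_val.sumElim continuous_const :
        Continuous (Sum.elim (fun z : range (g b) => (z : Z)) fun _ : Unit => infty))
    exact (IsEmbedding.inclusion hsub).metrizableSpace
  have key : ∀ a x, e a x ∈ range (glue e infty g) →
      a ∈ B ∧ glue e infty (only a) (e a x) = e a x := by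
    intro a x hx
    rw [hZ.range_glue] at hx
    rcases hx with hx | hx
    · exact absurd hx (hZ.apply_ne_infty x)
    obtain ⟨b, y, hy⟩ := mem_iUnion.1 hx
    have hyb : g b y ∈ range (e b) :=
      (hg b ⟨y, rfl⟩).resolve_left (hy ▸ hZ.apply_ne_infty x)
    obtain rfl : a = b := hZ.eq_of_mem_range ⟨x, rfl⟩ (hy ▸ hyb)
    refine ⟨fun hsub => hZ.apply_ne_infty x (hsub (hy ▸ ⟨y, rfl⟩)), ?_⟩
    rw [hZ.glue_apply, only_self, ← hZ.glue_apply g, ← hy, hidem]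
  have hoff : ∀ a c (y : X c), c ≠ a → glue e infty (only a) (e c y) = infty := by
    intro a c y hca
    rw [hZ.glue_apply, only_ne hca]
  let := Encodable.ofCountable B
  let := fun b : B => metrizableSpaceMetric (range (glue e infty (only b)))
  refine Metric.PiNatEmbed.TopologicalSpace.MetrizableSpace.of_countable_separating
    (fun (b : B) (z : range (glue e infty g)) => rangeFactorization (glue e infty (only b)) z)
    (fun b => ((hcont b).comp continuous_subtype_val).subtype_mk _) ?_
  rintro ⟨z, hz⟩ ⟨w, hw⟩ hzw
  by_contra! hall
  have hall' : ∀ b ∈ B, glue e infty (only b) z = glue e infty (only b) w := fun b hb =>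
    congrArg Subtype.val (hall ⟨b, hb⟩)
  refine hzw (Subtype.ext ?_)
  rcases hZ.eq_infty_or_exists z with rfl | ⟨a, x, rfl⟩ <;>
    rcases hZ.eq_infty_or_exists w with rfl | ⟨c, y, rfl⟩
  · rfl
  · obtain ⟨hb, hy⟩ := key c y hw
    have := hall' c hb
    rwa [hZ.glue_infty, hy] at this
  · obtain ⟨hb, hx⟩ := key a x hz
    have := hall' a hb
    rwa [hZ.glue_infty, hx] at this
  · obtain ⟨hb, hx⟩ := key a x hz
    have := hall' a hb
    rcases eq_or_ne c a with rfl | hca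
    · rwa [hx, (key c y hw).2] at this
    · rw [hx, hoff a c y hca] at this
      exact absurd this (hZ.apply_ne_infty x)

/-- The retraction `r σ`, regarded as a map into `Z` through `e`; the additional index `⊥`
stands for the constant map to the added point. -/
noncomputable def withBotMap {X Z Γ : Type*} (e : X → Z) (infty : Z) (r : Γ → X → X)
    (σ : WithBot Γ) : X → Z :=
  WithBot.recBotCoe (fun _ => infty) (fun g x => e (r g x)) σ

/-- An increasing sequence in `WithBot Γ` is constantly `⊥` or eventually takes values in `Γ`, so
suprema and pointwise limits survive adding `⊥` to the index poset. -/
theorem exists_isLUB_withBotMap {X Z : Type*} [TopologicalSpace X] [TopologicalSpace Z] {Γ : Type*}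
    [PartialOrder Γ] {r : Γ → X → X} (h : IsFullSkeleton r) {e : X → Z} (he : Continuous e)
    (infty : Z) {σ : ℕ → WithBot Γ} (hσ : Monotone σ) :
    ∃ τ, IsLUB (range σ) τ ∧
      ∀ x, Tendsto (fun n => withBotMap e infty r (σ n) x) atTop (𝓝 (withBotMap e infty r τ x)) := by
  by_cases hbot : ∀ n, σ n = ⊥
  · refine ⟨⊥, ⟨?_, fun _ _ => bot_le⟩, fun x => ?_⟩
    · rintro _ ⟨n, rfl⟩
      exact (hbot n).le
    · simp only [hbot]
      exact tendsto_const_nhds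
  push Not at hbot
  obtain ⟨N, hN⟩ := hbot
  have hne : ∀ n, ∃ u : Γ, σ (n + N) = u := fun n =>
    (WithBot.ne_bot_iff_exists.1 (ne_bot_of_le_ne_bot hN (hσ (Nat.le_add_left N n)))).imp
      fun _ hu => hu.symm
  choose u hu using hne
  have hu_mono : Monotone u := fun m n hmn => by
    rw [← WithBot.coe_le_coe, ← hu, ← hu]
    exact hσ (Nat.add_le_add_right hmn N)
  obtain ⟨τ, hτ, hlim⟩ := h.exists_sup u hu_mono
  refine ⟨τ, isLUB_range_withBot_coe hσ hu hτ, fun x => ?_⟩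
  rw [← tendsto_add_atTop_iff_nat N]
  simp only [hu]
  exact (he.tendsto _).comp (hlim x)

/-- The skeleton is indexed by the countably supported choices of an index in some of the
summands; summands without a chosen index are collapsed to the added point. -/
theorem isNoncommCorson [T35Space Z] (hX : ∀ a, IsNoncommCorson (X a))
    (hZ : IsOnePointCountablyCompactModification X Z e infty) : IsNoncommCorson Z := by
  classical
  choose Γ inst r h using fun a => (hX a).exists_isFullSkeleton
  let Δ := {s : ∀ a, WithBot (Γ a) // {a | s a ≠ ⊥}.Countable}
  let g : Δ → ∀ a, X a → Z := fun s a => withBotMap (e a) infty (r a) (s.1 a)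
  have he : ∀ a, Continuous (e a) := fun a => (hZ.isEmbedding a).continuous
  have g_bot : ∀ {s : Δ} {a}, s.1 a = ⊥ → g s a = fun _ => infty := fun hs => by
    simp only [g, hs]
    rfl
  have g_coe : ∀ {s : Δ} {a} {γ : Γ a}, s.1 a = γ → g s a = fun x => e a (r a γ x) := fun hs => by
    simp only [g, hs]
    rfl
  have cases_index : ∀ (s : Δ) a, s.1 a = ⊥ ∨ ∃ γ : Γ a, s.1 a = γ := fun s a => by
    cases s.1 a with
    | bot => exact Or.inl rfl
    | coe γ => exact Or.inr ⟨γ, rfl⟩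
  have hc : ∀ s a, Continuous (g s a) := by
    intro s a
    rcases cases_index s a with hs | ⟨γ, hs⟩
    · rw [g_bot hs]
      exact continuous_const
    · rw [g_coe hs]
      exact (he a).comp ((h a).continuous γ)
  have hg : ∀ s a, range (g s a) ⊆ insert infty (range (e a)) := by
    rintro s a _ ⟨x, rfl⟩
    rcases cases_index s a with hs | ⟨γ, hs⟩
    · rw [g_bot hs]
      exact mem_insert _ _
    · rw [g_coe hs]
      exact Or.inr ⟨_, rfl⟩
  have range_coe : ∀ {a} (γ : Γ a), range (fun x => e a (r a γ x)) =
      range fun z : range (r a γ) => e a z := by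
    intro a γ
    ext z
    constructor
    · rintro ⟨x, rfl⟩
      exact ⟨⟨_, x, rfl⟩, rfl⟩
    · rintro ⟨⟨_, x, rfl⟩, rfl⟩
      exact ⟨x, rfl⟩
  have hcompact : ∀ {a} (γ : Γ a), CompactSpace (range (r a γ)) := fun γ =>
    isCompact_iff_compactSpace.1 ((h _).isCompact_range γ)
  have hk : ∀ s a, IsCompact (range (g s a)) := by
    intro s a
    rcases cases_index s a with hs | ⟨γ, hs⟩
    · rw [g_bot hs]
      exact (finite_range_const (c := infty)).isCompact
    · have := hcompact γ
      rw [g_coe hs, range_coe]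
      exact isCompact_range ((he a).comp continuous_subtype_val)
  have hm : ∀ s a, MetrizableSpace (range (g s a)) := by
    intro s a
    rcases cases_index s a with hs | ⟨γ, hs⟩
    · have hsub : range (g s a) ⊆ range fun _ : Unit => infty := by
        rw [g_bot hs]
        rintro _ ⟨x, rfl⟩
        exact ⟨(), rfl⟩
      have := metrizableSpace_range_of_compactSpace
        (continuous_const : Continuous fun _ : Unit => infty)
      exact (IsEmbedding.inclusion hsub).metrizableSpace
    · have := hcompact γ
      have := (h a).metrizable_range γ
      rw [g_coe hs, range_coe]
      exact metrizableSpace_range_of_compactSpace ((he a).comp continuous_subtype_val)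
  have hleft : ∀ s t : Δ, s ≤ t → ∀ a x, glue e infty (g t) (g s a x) = g s a x := by
    intro s t hst a x
    rcases cases_index s a with hs | ⟨γ, hs⟩
    · rw [g_bot hs, hZ.glue_infty]
    · rcases cases_index t a with ht | ⟨δ, ht⟩
      · exact absurd (ht ▸ hs ▸ hst a) (WithBot.not_coe_le_bot γ)
      · have hγδ : γ ≤ δ := WithBot.coe_le_coe.1 (ht ▸ hs ▸ hst a)
        rw [g_coe hs, hZ.glue_apply, g_coe ht]
        exact congrArg (e a) ((h a).comp_eq_left γ δ hγδ x)
  have hright : ∀ s t : Δ, s ≤ t → ∀ a x, glue e infty (g s) (g t a x) = g s a x := by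
    intro s t hst a x
    rcases cases_index t a with ht | ⟨δ, ht⟩
    · have hs : s.1 a = ⊥ := le_bot_iff.1 (ht ▸ hst a)
      rw [g_bot ht, g_bot hs, hZ.glue_infty]
    · rw [g_coe ht, hZ.glue_apply]
      rcases cases_index s a with hs | ⟨γ, hs⟩
      · rw [g_bot hs]
      · have hγδ : γ ≤ δ := WithBot.coe_le_coe.1 (ht ▸ hs ▸ hst a)
        rw [g_coe hs]
        exact congrArg (e a) ((h a).comp_eq_right γ δ hγδ x)
  have hcount : ∀ s : Δ, {a | ¬ range (g s a) ⊆ {infty}}.Countable := by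
    refine fun s => s.2.mono fun a ha => ?_
    by_contra hs
    refine ha ?_
    rw [g_bot (not_not.1 hs)]
    rintro _ ⟨x, rfl⟩
    rfl
  have hr : IsFullSkeleton fun s : Δ => glue e infty (g s) := by
    refine ⟨⟨⟨fun _ => ⊥, by simp⟩⟩, fun s t => ?_, fun s => hZ.continuous_glue (hc s) (hg s),
      fun s => hZ.isCompact_range_glue (hk s) (hg s), fun s =>
      hZ.metrizableSpace_range_glue (hc s) (hk s) (hm s) (hg s) (hleft s s le_rfl) (hcount s),
      fun s t hst z => ?_, fun s t hst z => ?_, fun s hs => ?_, fun z => ?_⟩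
    · have hdir : ∀ a, ∃ p, s.1 a ≤ p ∧ t.1 a ≤ p ∧ (s.1 a = ⊥ → t.1 a = ⊥ → p = ⊥) := by
        intro a
        rcases cases_index s a with hs | ⟨γ, hs⟩ <;> rcases cases_index t a with ht | ⟨δ, ht⟩
        · exact ⟨⊥, hs.le, ht.le, fun _ _ => rfl⟩
        · exact ⟨t.1 a, hs ▸ bot_le, le_rfl, fun _ ht' => ht'⟩
        · exact ⟨s.1 a, le_rfl, ht ▸ bot_le, fun hs' _ => hs'⟩
        · obtain ⟨p, hp, hp'⟩ := (h a).directed γ δ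
          exact ⟨p, hs ▸ WithBot.coe_le_coe.2 hp, ht ▸ WithBot.coe_le_coe.2 hp',
            fun hs' => absurd (hs.symm.trans hs') WithBot.coe_ne_bot⟩
      choose p hsp htp hbot using hdir
      refine ⟨⟨p, (s.2.union t.2).mono fun a ha => ?_⟩, hsp, htp⟩
      by_contra hst
      rw [mem_union, not_or] at hst
      exact ha (hbot a (not_not.1 hst.1) (not_not.1 hst.2))
    · rcases hZ.eq_infty_or_exists z with rfl | ⟨a, x, rfl⟩
      · simp only [hZ.glue_infty]
      · rw [hZ.glue_apply, hleft s t hst]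
    · rcases hZ.eq_infty_or_exists z with rfl | ⟨a, x, rfl⟩
      · simp only [hZ.glue_infty]
      · rw [hZ.glue_apply, hZ.glue_apply, hright s t hst]
    · choose t ht hlim using fun a =>
        exists_isLUB_withBotMap (h a) (he a) infty (σ := fun n => (s n).1 a) fun m n hmn => hs hmn a
      have htc : {a | t a ≠ ⊥}.Countable := by
        refine (countable_iUnion fun n => (s n).2).mono fun a ha => ?_
        by_contra hall
        rw [mem_iUnion, not_exists] at hall
        refine ha (le_bot_iff.1 ((ht a).2 ?_))
        rintro _ ⟨n, rfl⟩
        exact (not_not.1 (hall n)).le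
      have hlub : IsLUB (range fun n => (s n).1) t := isLUB_range_pi ht
      refine ⟨⟨t, htc⟩, ⟨?_, fun q hq => hlub.2 ?_⟩, fun z => ?_⟩
      · rintro _ ⟨n, rfl⟩
        exact hlub.1 ⟨n, rfl⟩
      · rintro _ ⟨n, rfl⟩
        exact hq ⟨n, rfl⟩
      · rcases hZ.eq_infty_or_exists z with rfl | ⟨a, x, rfl⟩
        · simp only [hZ.glue_infty]
          exact tendsto_const_nhds
        · simp only [hZ.glue_apply]
          exact hlim a x
    · rcases hZ.eq_infty_or_exists z with rfl | ⟨a, x, rfl⟩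
      · exact ⟨⟨fun _ => ⊥, by simp⟩, hZ.glue_infty _⟩
      · obtain ⟨γ, hγ⟩ := (h a).exists_fixed x
        refine ⟨⟨Function.update (fun _ => ⊥) a (γ : WithBot (Γ a)),
          (countable_singleton a).mono fun b hb => ?_⟩, ?_⟩
        · by_contra hba
          exact hb (Function.update_of_ne hba _ _)
        · have hself : Function.update (fun b => (⊥ : WithBot (Γ b))) a γ a = γ :=
            Function.update_self _ _ _
          rw [hZ.glue_apply, g_coe hself]
          exact congrArg (e a) hγ
  exact hr.isNoncommCorson

end IsOnePointCountablyCompactModification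

theorem mainTheorem1 :
    -- (1) countably closed subspaces
    (∀ (X : Type u) [TopologicalSpace X] (Y : Set X),
      IsNoncommCorson X → IsCountablyClosed Y → IsNoncommCorson Y) ∧
    -- (2) countable products
    (∀ (ι : Type v) [Countable ι] (X : ι → Type u) [∀ i, TopologicalSpace (X i)],
      (∀ i, IsNoncommCorson (X i)) → IsNoncommCorson (∀ i, X i)) ∧
    -- (3) finite topological sums
    (∀ (ι : Type v) [Finite ι] (X : ι → Type u) [∀ i, TopologicalSpace (X i)],
      (∀ i, IsNoncommCorson (X i)) → IsNoncommCorson (Σ i, X i)) ∧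
    -- (4) one-point countably compact modifications of topological sums
    (∀ (A : Type v) (X : A → Type u) [∀ a, TopologicalSpace (X a)]
      (Z : Type (max u v)) [TopologicalSpace Z] [T35Space Z] (e : ∀ a, X a → Z) (infty : Z),
      (∀ a, IsNoncommCorson (X a)) → IsOnePointCountablyCompactModification X Z e infty →
        IsNoncommCorson Z) ∧
    -- (5) quotient images
    (∀ (X Y : Type u) [TopologicalSpace X] [TopologicalSpace Y] [T35Space Y] (f : X → Y),
      IsNoncommCorson X → IsQuotientMap f → IsNoncommCorson Y) := by
  refine ⟨fun X _ Y hX hY => hX.of_isCountablyClosed hY, fun ι _ X _ hX => .pi hX,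
    fun ι _ X _ hX => .sigma hX, fun A X _ Z _ _ e infty hX hZ => hZ.isNoncommCorson hX,
    fun X Y _ _ _ f hX hf => hX.of_isQuotientMap hf⟩
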